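/- Let $d\ge 1$, $V=\{1,\dots,d\}$, $\mathcal E=[0,\infty)^d\setminus\{\boldsymbol 0\}$ and $\mathcal L=\{\boldsymbol x\in\mathcal E:\|\boldsymbol x\|_\infty>1\}$. Let $\lambda$ be an exponent measure density that is positive and continuous on $(0,\infty)^d$, homogeneous of order $-(d+1)$, i.e. $\lambda(t\boldsymbol y)=t^{-(d+1)}\lambda(\boldsymbol y)$ for $t>0$, and with normalised marginals, i.e. $\int_{\{\boldsymbol y\in\mathcal E:\,y_i>1\}}\lambda(\boldsymbol y)\,\mathrm d\boldsymbol y=1$ for every $i\in V$. Let $\Lambda$ be the measure on $\mathcal E$ with Lebesgue density $\lambda$, write $\Lambda(\boldsymbol z)=\Lambda(\mathcal E\setminus[\boldsymbol 0,\boldsymbol z])$, and let $\boldsymbol Y$ be a random vector with the associated multivariate Pareto distribution on $\mathcal L$, that is, $\mathbb P(\boldsymbol Y\le\boldsymbol z)=\{\Lambda(\boldsymbol z\wedge\boldsymbol 1)-\Lambda(\boldsymbol z)\}/\Lambda(\boldsymbol 1)$ for $\boldsymbol z\in\mathcal E$ (read as $0$ if some $z_i=0$, when both $\Lambda$-terms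 are infinite). For $k\in V$ let $\boldsymbol Y^k$ denote a random vector distributed as $\boldsymbol Y$ conditioned on $\{Y_k>1\}$. (1) For every $k\in V$, the distribution of the extremal function $\boldsymbol U^k$ of $\boldsymbol Y$ relative to coordinate $k$, i.e. of the $d$-dimensional random vector $\boldsymbol U^k$ with $U^k_k=1$ almost surely such that $\boldsymbol U^k_{\setminus k}=(U^k_i)_{i\ne k}$ has a density satisfying $\lambda(\boldsymbol y)=y_k^{-(d+1)}f_{\boldsymbol U^k_{\setminus k}}(\boldsymbol y_{\setminus k}/y_k)$ for all $\boldsymbol y\in(0,\infty)^d$, exists, is unique, and is the distribution of $\boldsymbol Y^k/Y^k_k$. (2) Let $P$ be a standard Pareto random variable (density $u^{-2}$ for $u\ge 1$) and let $T$ be uniformly distributed on $\{1,\dots,d\}$, such that $P$, $T$ and the family $(\boldsymbol Y^k)_{k\in V}$ are independent. Then $\boldsymbol Y$ has the distribution of $P\boldsymbol Y^T/\|\boldsymbol Y^T\|_1$ conditioned on the event $P\|\boldsymbol Y^T\|_\infty/\|\boldsymbol Y^T\|_1>1$; in particular, for any Borel set $A\subset\mathcal L$, $$\mathbb P(\boldsymbol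 Y\in A)=\mathbb P\left(\frac{P\boldsymbol Y^T}{\|\boldsymbol Y^T\|_1}\in A\,\Big|\,\frac{P\|\boldsymbol Y^T\|_\infty}{\|\boldsymbol Y^T\|_1}>1\right).$$ (3) The probability of the conditioning event (the acceptance probability of the corresponding rejection sampler) is $$\mathbb P\left(\frac{P\|\boldsymbol Y^T\|_\infty}{\|\boldsymbol Y^T\|_1}>1\right)=\frac{\Lambda(\boldsymbol 1)}{d}.$$ -/

import Mathlib

open MeasureTheory ProbabilityTheory
open scoped ENNReal

universe u v

noncomputable section

namespace ExtremalPareto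

/-- The cone `𝓔 = [0,∞)^d \ {0}`. -/
def cone (d : ℕ) : Set (Fin d → ℝ) := {x | (∀ i, 0 ≤ x i) ∧ x ≠ 0}

/-- The L-shaped space `𝓛 = {x ∈ 𝓔 : ‖x‖_∞ > 1}`
(the norm of `Fin d → ℝ` is the maximum norm). -/
def lShape (d : ℕ) : Set (Fin d → ℝ) := {x ∈ cone d | 1 < ‖x‖}

/-- The `ℓ₁`-norm of a vector. -/
def normOne {d : ℕ} (x : Fin d → ℝ) : ℝ := ∑ i, |x i|

/-- A positive continuous exponent measure density: homogeneous of order `-(d+1)` and with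
normalised marginals. The pointwise conditions are only imposed on the open orthant `(0,∞)^d`,
since the values of a density on the (Lebesgue-null) boundary faces carry no information and, for
common models, vanish or are undefined there. -/
structure IsExponentDensity {d : ℕ} (lam : (Fin d → ℝ) → ℝ) : Prop where
  pos : ∀ y : Fin d → ℝ, (∀ i, 0 < y i) → 0 < lam y
  cont : ContinuousOn lam {y | ∀ i, 0 < y i}
  homogeneous : ∀ t : ℝ, 0 < t → ∀ y : Fin d → ℝ, (∀ i, 0 < y i) →
    lam (t • y) = t ^ (-((d : ℤ) + 1)) * lam y
  marginal : ∀ i, ∫⁻ y in {y | y ∈ cone d ∧ 1 < y i}, ENNReal.ofReal (lam y) = 1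

/-- The exponent measure `Λ` on `𝓔` with Lebesgue density `lam`. -/
def exponentMeasure {d : ℕ} (lam : (Fin d → ℝ) → ℝ) : Measure (Fin d → ℝ) :=
  (volume.restrict (cone d)).withDensity fun y => ENNReal.ofReal (lam y)

/-- `Λ(z) = Λ(𝓔 \ [0,z])`. In particular `Λ(1)` is the extremal coefficient. -/
def exponentFun {d : ℕ} (lam : (Fin d → ℝ) → ℝ) (z : Fin d → ℝ) : ℝ≥0∞ :=
  exponentMeasure lam (cone d \ Set.Icc 0 z)

/-- `ρ` is the multivariate Pareto distribution associated with `lam`: it lives on `𝓛` and its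
distribution function is `(Λ(z ∧ 1) - Λ(z)) / Λ(1)` for `z ∈ 𝓔`. (If a coordinate of `z` is zero,
both terms are infinite; their truncated difference is the correct value `0`.) -/
structure IsMultivariatePareto {d : ℕ} (lam : (Fin d → ℝ) → ℝ)
    (ρ : Measure (Fin d → ℝ)) : Prop where
  prob : IsProbabilityMeasure ρ
  support : ∀ᵐ y ∂ρ, y ∈ lShape d
  cdf : ∀ z ∈ cone d,
    ρ (Set.Iic z) = (exponentFun lam (z ⊓ 1) - exponentFun lam z) / exponentFun lam 1

/-- `ρ` is the law of the extremal function `U` relative to coordinate `k`: `U_k = 1` almost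
surely, and the subvector of the coordinates of `U` other than `k` has a Lebesgue density `f` with
`lam y = y_k^{-(d+1)} f (y_{\k} / y_k)`. -/
structure IsExtremalFunctionLaw {d : ℕ} (lam : (Fin d → ℝ) → ℝ) (k : Fin d)
    (ρ : Measure (Fin d → ℝ)) : Prop where
  prob : IsProbabilityMeasure ρ
  coord_eq_one : ∀ᵐ u ∂ρ, u k = 1
  density : ∃ f : ({i : Fin d // i ≠ k} → ℝ) → ℝ, Measurable f ∧ (∀ w, 0 ≤ f w) ∧
    ρ.map (fun u (i : {i : Fin d // i ≠ k}) => u i) =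
      volume.withDensity (fun w => ENNReal.ofReal (f w)) ∧
    ∀ y : Fin d → ℝ, (∀ i, 0 < y i) →
      lam y = (y k) ^ (-((d : ℤ) + 1)) * f (fun i => y i / y k)

end ExtremalPareto

end

namespace ExtremalPareto

/-! Homogeneity gives a polar decomposition along each coordinate `k` (`lintegral_exponentMeasure`):
`Λ` is the image of `u⁻² du ⊗ Q_k` under `(u, U) ↦ u • U`, where `Q_k = extremalLaw lam k` lives on
`{U k = 1}`. Hence `Λ` restricted to `{y_k > 1}` and divided by `y_k` is `Q_k`, of mass one by the
marginal normalisation. The law of `Y` is `Λ` conditioned on `𝓛` (`eq_of_isMultivariatePareto`), so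
`Y^k` has law `Λ` restricted to `{y_k > 1}`, and `Y^k / Y^k_k` has law `Q_k`. Uniqueness holds
because the prescribed values of the density on the open orthant already have integral one. For the
sampler, the weights `y_k / ‖y‖₁` form a partition of unity. Applying the `k`-th polar decomposition
to the `k`-th piece and substituting `p = u‖U‖₁` makes the radius standard Pareto
(`setLIntegral_one_lt_normOne`). Thus `P Y^T / ‖Y^T‖₁` has law `d⁻¹ Λ` restricted to `{‖y‖₁ > 1}`.
This set contains `𝓛`, so conditioning on `𝓛` recovers `Y`, and the acceptance probability is `Λ(𝓛)
/ d`. -/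

/-! ### The density on the open orthant. -/

/-- The open orthant `(0,∞)^d`. -/
def orthant (d : ℕ) : Set (Fin d → ℝ) := {y | ∀ i, 0 < y i}

lemma isOpen_orthant (d : ℕ) : IsOpen (orthant d) := by
  have : orthant d = ⋂ i, {y | 0 < y i} := by ext; simp [orthant]
  rw [this]
  exact isOpen_iInter_of_finite fun i => isOpen_lt continuous_const (continuous_apply i)

lemma measurableSet_orthant (d : ℕ) : MeasurableSet (orthant d) :=
  (isOpen_orthant d).measurableSet

lemma measurableSet_cone (d : ℕ) : MeasurableSet (cone d) := by
  have : cone d = (⋂ i, {y | 0 ≤ y i}) \ {0} := by ext; simp [cone]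
  rw [this]
  exact (MeasurableSet.iInter fun i => measurableSet_le measurable_const (measurable_pi_apply i)).diff
    (measurableSet_singleton 0)

lemma measurableSet_lShape (d : ℕ) : MeasurableSet (lShape d) :=
  (measurableSet_cone d).inter (measurableSet_lt measurable_const measurable_norm)

/-- The exponent measure density, set to zero off the open orthant. -/
noncomputable def orthantDensity {d : ℕ} (lam : (Fin d → ℝ) → ℝ) : (Fin d → ℝ) → ℝ≥0∞ :=
  (orthant d).indicator fun y => ENNReal.ofReal (lam y)

/-- The index `k` excludes `d = 0`, where the cone is empty but the orthant is a point. -/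
lemma cone_ae_eq_orthant {d : ℕ} (k : Fin d) : cone d =ᵐ[volume] orthant d := by
  have h : ∀ᵐ y : Fin d → ℝ, ∀ i, y i ≠ 0 :=
    ae_all_iff.2 fun i => Measure.ae_eval_ne (μ := fun _ : Fin d => (volume : Measure ℝ)) i 0
  filter_upwards [h] with y hy
  refine propext ⟨fun hc i => lt_of_le_of_ne (hc.1 i) (hy i).symm, fun ho => ⟨fun i => (ho i).le, ?_⟩⟩
  rintro rfl
  exact hy k rfl

variable {d : ℕ} {lam : (Fin d → ℝ) → ℝ}

lemma exponentMeasure_eq (k : Fin d) :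
    exponentMeasure lam = volume.withDensity (orthantDensity lam) := by
  rw [exponentMeasure, Measure.restrict_congr_set (cone_ae_eq_orthant k), orthantDensity,
    withDensity_indicator (measurableSet_orthant d)]

/-- Off the orthant `lam` is arbitrary, so measurability is only available after the cut-off. -/
lemma IsExponentDensity.measurable_orthantDensity (hlam : IsExponentDensity lam) :
    Measurable (orthantDensity lam) := by
  classical
  have h : orthantDensity lam = fun y => ENNReal.ofReal ((orthant d).piecewise lam 0 y) := by
    funext y
    by_cases hy : y ∈ orthant d <;> simp [orthantDensity, hy]
  rw [h]
  exact (ContinuousOn.measurable_piecewise (g := 0) (s := orthant d) hlam.cont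
    continuousOn_const (measurableSet_orthant d)).ennreal_ofReal

lemma smul_mem_orthant {t : ℝ} (ht : 0 < t) {y : Fin d → ℝ} :
    t • y ∈ orthant d ↔ y ∈ orthant d := by
  simp [orthant, ht]

lemma IsExponentDensity.orthantDensity_smul (hlam : IsExponentDensity lam) {t : ℝ} (ht : 0 < t)
    (y : Fin d → ℝ) :
    orthantDensity lam (t • y) =
      ENNReal.ofReal (t ^ (-((d : ℤ) + 1))) * orthantDensity lam y := by
  by_cases hy : y ∈ orthant d
  · rw [orthantDensity, Set.indicator_of_mem ((smul_mem_orthant ht).2 hy),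
      Set.indicator_of_mem hy, hlam.homogeneous t ht y hy, ENNReal.ofReal_mul (by positivity)]
  · rw [orthantDensity, Set.indicator_of_notMem (by rwa [smul_mem_orthant ht]),
      Set.indicator_of_notMem hy, mul_zero]

/-! ### Splitting off one coordinate, and scaling of Lebesgue measure. -/

/-- The vector with `k`-th coordinate `u` and remaining coordinates `w`. -/
def insertAt (k : Fin d) (u : ℝ) (w : {i : Fin d // i ≠ k} → ℝ) : Fin d → ℝ :=
  fun i => if h : i = k then u else w ⟨i, h⟩

@[simp] lemma insertAt_self (k : Fin d) (u : ℝ) (w : {i : Fin d // i ≠ k} → ℝ) :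
    insertAt k u w k = u := by simp [insertAt]

@[simp] lemma insertAt_coe (k : Fin d) (u : ℝ) (w : {i : Fin d // i ≠ k} → ℝ)
    (i : {i : Fin d // i ≠ k}) : insertAt k u w i = w i := by simp [insertAt, i.2]

lemma insertAt_restrict (k : Fin d) (y : Fin d → ℝ) :
    insertAt k (y k) (fun i => y i) = y := by
  funext i
  by_cases h : i = k
  · subst h; simp
  · simp [insertAt, h]

lemma insertAt_smul (k : Fin d) (u : ℝ) (w : {i : Fin d // i ≠ k} → ℝ) :
    insertAt k u (u • w) = u • insertAt k 1 w := by
  funext i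
  by_cases h : i = k
  · subst h; simp
  · simp [insertAt, h]

lemma measurable_insertAt (k : Fin d) :
    Measurable fun p : ℝ × ({i : Fin d // i ≠ k} → ℝ) => insertAt k p.1 p.2 := by
  refine measurable_pi_lambda _ fun i => ?_
  by_cases h : i = k
  · simpa [insertAt, h] using measurable_fst
  · simp only [insertAt, h, dite_false]; fun_prop

lemma measurable_insertAt_right (k : Fin d) (u : ℝ) : Measurable (insertAt k u) :=
  (measurable_insertAt k).comp measurable_prodMk_left

lemma measurable_comp_insertAt {F : (Fin d → ℝ) → ℝ≥0∞} (hF : Measurable F) (k : Fin d) (u : ℝ) :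
    Measurable fun w => F (insertAt k u w) :=
  hF.comp (measurable_insertAt_right k u)

lemma measurePreserving_insertAt (k : Fin d) :
    MeasurePreserving fun p : ℝ × ({i : Fin d // i ≠ k} → ℝ) => insertAt k p.1 p.2 := by
  refine ⟨measurable_insertAt k, ?_⟩
  refine (Measure.pi_eq fun s hs => ?_).symm
  rw [Measure.map_apply (measurable_insertAt k) (MeasurableSet.univ_pi hs)]
  have : (fun p : ℝ × ({i : Fin d // i ≠ k} → ℝ) => insertAt k p.1 p.2) ⁻¹' Set.univ.pi s =
      s k ×ˢ Set.univ.pi fun i : {i : Fin d // i ≠ k} => s i := by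
    ext ⟨u, w⟩
    simp only [Set.mem_preimage, Set.mem_pi, Set.mem_univ, true_imp_iff, Set.mem_prod]
    constructor
    · exact fun h => ⟨by simpa using h k, fun i => by simpa using h i⟩
    · rintro ⟨h1, h2⟩ i
      by_cases h : i = k
      · subst h; simpa using h1
      · simpa [insertAt, h] using h2 ⟨i, h⟩
  rw [this, Measure.volume_eq_prod, Measure.prod_prod, volume_pi_pi,
    Fintype.prod_eq_mul_prod_subtype_ne _ k]

lemma lintegral_eq_lintegral_insertAt (k : Fin d) {F : (Fin d → ℝ) → ℝ≥0∞} (hF : Measurable F) :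
    ∫⁻ y, F y = ∫⁻ u, ∫⁻ w, F (insertAt k u w) := by
  rw [← (measurePreserving_insertAt k).lintegral_comp hF, Measure.volume_eq_prod,
    lintegral_prod (fun p : ℝ × ({i : Fin d // i ≠ k} → ℝ) => F (insertAt k p.1 p.2))
      (hF.comp (measurable_insertAt k)).aemeasurable]

lemma lintegral_eq_lintegral_comp_smul {E : Type*} [NormedAddCommGroup E] [NormedSpace ℝ E]
    [FiniteDimensional ℝ E] [MeasurableSpace E] [BorelSpace E] (ν : Measure E) [ν.IsAddHaarMeasure]
    {u : ℝ} (hu : 0 < u) {G : E → ℝ≥0∞} (hG : Measurable G) :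
    ∫⁻ w, G w ∂ν = ENNReal.ofReal (u ^ Module.finrank ℝ E) * ∫⁻ w, G (u • w) ∂ν := by
  have h := Measure.map_addHaar_smul ν hu.ne'
  rw [← lintegral_map hG (measurable_const_smul u), h, lintegral_smul_measure,
    smul_eq_mul, ← mul_assoc,
    ← ENNReal.ofReal_mul (by positivity), abs_of_pos (by positivity),
    mul_inv_cancel₀ (by positivity), ENNReal.ofReal_one, one_mul]

/-! ### Polar decomposition of the exponent measure along a coordinate. -/

/-- The law of the extremal function relative to coordinate `k`: its `k`-th coordinate is one and
the remaining ones have density `w ↦ lam (1, w)`. -/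
noncomputable def extremalLaw (lam : (Fin d → ℝ) → ℝ) (k : Fin d) : Measure (Fin d → ℝ) :=
  (volume.withDensity fun w => orthantDensity lam (insertAt k 1 w)).map (insertAt k 1)

lemma IsExponentDensity.lintegral_extremalLaw (hlam : IsExponentDensity lam) (k : Fin d)
    {g : (Fin d → ℝ) → ℝ≥0∞} (hg : Measurable g) :
    ∫⁻ U, g U ∂extremalLaw lam k =
      ∫⁻ w, orthantDensity lam (insertAt k 1 w) * g (insertAt k 1 w) := by
  rw [extremalLaw, lintegral_map hg (measurable_insertAt_right k 1),
    lintegral_withDensity_eq_lintegral_mul _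
      (measurable_comp_insertAt hlam.measurable_orthantDensity k 1)
      (measurable_comp_insertAt hg k 1)]
  rfl

lemma IsExponentDensity.ae_extremalLaw (hlam : IsExponentDensity lam) (k : Fin d) :
    ∀ᵐ U ∂extremalLaw lam k, U ∈ orthant d ∧ U k = 1 := by
  have hms : MeasurableSet {U : Fin d → ℝ | U ∈ orthant d ∧ U k = 1} :=
    (measurableSet_orthant d).inter (measurableSet_eq_fun (measurable_pi_apply k) measurable_const)
  rw [extremalLaw, ae_map_iff (measurable_insertAt_right k 1).aemeasurable hms,
    ae_withDensity_iff (measurable_comp_insertAt hlam.measurable_orthantDensity k 1)]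
  refine ae_of_all _ fun w hw => ⟨?_, by simp⟩
  by_contra h
  exact hw (Set.indicator_of_notMem h _)

/-- Write `y = (u, w)` with `u = y_k` and substitute `w = u w'`: homogeneity separates `u` from the
direction `(1, w')`. -/
lemma IsExponentDensity.lintegral_exponentMeasure (hlam : IsExponentDensity lam) (k : Fin d)
    {g : (Fin d → ℝ) → ℝ≥0∞} (hg : Measurable g) :
    ∫⁻ y, g y ∂exponentMeasure lam =
      ∫⁻ U, (∫⁻ u in Set.Ioi (0 : ℝ), ENNReal.ofReal ((u ^ 2)⁻¹) * g (u • U))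
        ∂extremalLaw lam k := by
  have hD := hlam.measurable_orthantDensity
  have hsm : Measurable fun p : (Fin d → ℝ) × ℝ => ENNReal.ofReal ((p.2 ^ 2)⁻¹) * g (p.2 • p.1) := by
    fun_prop
  have hcard : Fintype.card {i : Fin d // i ≠ k} + 1 = d := by
    have := Fintype.card_subtype_compl (fun i : Fin d => i = k)
    have hd := k.pos
    simp at this
    simp; omega
  have hins := measurable_insertAt_right k 1
  rw [exponentMeasure_eq k, lintegral_withDensity_eq_lintegral_mul _ hD hg,
    lintegral_eq_lintegral_insertAt k (hD.mul hg),
    hlam.lintegral_extremalLaw k hsm.lintegral_prod_right']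
  have h0 : ∀ u, u ∉ Set.Ioi (0 : ℝ) →
      ∫⁻ w, (orthantDensity lam * g) (insertAt k u w) = 0 := by
    intro u hu
    rw [lintegral_eq_zero_iff' (measurable_comp_insertAt (hD.mul hg) k u).aemeasurable]
    refine ae_of_all _ fun w => ?_
    have : insertAt k u w ∉ orthant d := fun h => hu (by simpa using h k)
    simp [orthantDensity, this]
  rw [← setLIntegral_eq_of_support_subset (s := Set.Ioi (0 : ℝ))
    (fun u hu => by by_contra h; exact hu (h0 u h))]
  have h1 : ∀ u ∈ Set.Ioi (0 : ℝ), ∫⁻ w, (orthantDensity lam * g) (insertAt k u w) =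
      ∫⁻ w, orthantDensity lam (insertAt k 1 w) *
        (ENNReal.ofReal ((u ^ 2)⁻¹) * g (u • insertAt k 1 w)) := by
    intro u hu
    have hu : 0 < u := hu
    rw [lintegral_eq_lintegral_comp_smul _ hu (measurable_comp_insertAt (hD.mul hg) k u),
      Module.finrank_fintype_fun_eq_card,
      ← lintegral_const_mul' _ _ ENNReal.ofReal_ne_top]
    refine lintegral_congr fun w => ?_
    -- The Jacobian contributes `u^(d-1)` and homogeneity `u^(-(d+1))`.
    have hp : u ^ Fintype.card {i : Fin d // i ≠ k} * u ^ (-((d : ℤ) + 1)) = (u ^ 2)⁻¹ := by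
      rw [← zpow_natCast, ← zpow_add₀ hu.ne', ← zpow_natCast, ← zpow_neg]
      congr 1
      have : (Fintype.card {i : Fin d // i ≠ k} : ℤ) + 1 = d := by exact_mod_cast hcard
      push_cast
      linarith
    rw [insertAt_smul, Pi.mul_apply, hlam.orthantDensity_smul hu, ← hp,
      ENNReal.ofReal_mul (by positivity)]
    ring
  rw [setLIntegral_congr_fun measurableSet_Ioi h1, lintegral_lintegral_swap]
  · refine lintegral_congr fun w => ?_
    rw [lintegral_const_mul]
    exact hsm.comp measurable_prodMk_left
  · refine ((hD.comp (hins.comp measurable_snd)).mul ?_).aemeasurable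
    exact hsm.comp ((hins.comp measurable_snd).prodMk measurable_fst)

lemma lintegral_Ioi_inv_sq {c : ℝ} (hc : 0 < c) :
    ∫⁻ u in Set.Ioi c, ENNReal.ofReal ((u ^ 2)⁻¹) = ENNReal.ofReal c⁻¹ := by
  have h : ∀ u ∈ Set.Ioi c, u ^ (-2 : ℝ) = (u ^ 2)⁻¹ := fun u hu => by
    rw [Real.rpow_neg (hc.trans hu).le]
    norm_cast
  have hi := (integrableOn_Ioi_rpow_of_lt (show (-2 : ℝ) < -1 by norm_num) hc).congr_fun h
    measurableSet_Ioi
  rw [← ofReal_integral_eq_lintegral_ofReal hi (ae_of_all _ fun u => by positivity),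
    ← setIntegral_congr_fun measurableSet_Ioi h, integral_Ioi_rpow_of_lt (by norm_num) hc]
  congr 1
  rw [show (-2 : ℝ) + 1 = -1 by norm_num, Real.rpow_neg_one]
  ring

lemma measurableSet_lt_coord (k : Fin d) (c : ℝ) : MeasurableSet {y : Fin d → ℝ | c < y k} :=
  measurableSet_lt measurable_const (measurable_pi_apply k)

/-- As `U k = 1`, the point `y = u • U` has `y_k = u` and normalises to `U`, so the radius
integrates out. -/
lemma IsExponentDensity.lintegral_comp_normalize (hlam : IsExponentDensity lam) (k : Fin d)
    {c : ℝ} (hc : 0 < c) {h : (Fin d → ℝ) → ℝ≥0∞} (hh : Measurable h) :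
    ∫⁻ y in {y | c < y k}, h ((y k)⁻¹ • y) ∂exponentMeasure lam =
      ENNReal.ofReal c⁻¹ * ∫⁻ U, h U ∂extremalLaw lam k := by
  have hn : Measurable fun y : Fin d → ℝ => h ((y k)⁻¹ • y) := hh.comp (by fun_prop)
  rw [← lintegral_indicator (measurableSet_lt_coord k c),
    hlam.lintegral_exponentMeasure k (hn.indicator (measurableSet_lt_coord k c)),
    ← lintegral_const_mul _ hh]
  refine lintegral_congr_ae ?_
  filter_upwards [hlam.ae_extremalLaw k] with U ⟨_, hU⟩
  rw [← lintegral_Ioi_inv_sq hc, mul_comm, ← lintegral_const_mul _ (by fun_prop),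
    ← lintegral_indicator measurableSet_Ioi, ← lintegral_indicator measurableSet_Ioi]
  refine lintegral_congr fun u => ?_
  by_cases hu : c < u
  · have hu0 : 0 < u := hc.trans hu
    simp [Set.indicator, hu, hu0, hU, smul_smul, inv_mul_cancel₀ hu0.ne', mul_comm]
  · simp [Set.indicator, hu, hU]

lemma exponentMeasure_compl_cone : exponentMeasure lam (cone d)ᶜ = 0 := by
  refine withDensity_absolutelyContinuous _ _ ?_
  rw [Measure.restrict_apply (measurableSet_cone d).compl, Set.compl_inter_self, measure_empty]

lemma ae_exponentMeasure_mem_orthant (k : Fin d) :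
    ∀ᵐ y ∂exponentMeasure lam, y ∈ orthant d := by
  refine (withDensity_absolutelyContinuous _ _).ae_le ?_
  rw [Measure.restrict_congr_set (cone_ae_eq_orthant k)]
  exact ae_restrict_mem (measurableSet_orthant d)

lemma IsExponentDensity.exponentMeasure_one_lt (hlam : IsExponentDensity lam) (k : Fin d) :
    exponentMeasure lam {y | 1 < y k} = 1 := by
  rw [exponentMeasure, withDensity_apply _ (measurableSet_lt_coord k 1),
    Measure.restrict_restrict (measurableSet_lt_coord k 1), ← hlam.marginal k]
  congr 2
  ext y
  exact and_comm

lemma IsExponentDensity.isProbabilityMeasure_extremalLaw (hlam : IsExponentDensity lam)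
    (k : Fin d) : IsProbabilityMeasure (extremalLaw lam k) := by
  constructor
  have h := hlam.lintegral_comp_normalize k one_pos (h := fun _ => 1) measurable_const
  simpa [hlam.exponentMeasure_one_lt k] using h.symm

lemma IsExponentDensity.exponentMeasure_lt (hlam : IsExponentDensity lam) (k : Fin d)
    {c : ℝ} (hc : 0 < c) : exponentMeasure lam {y | c < y k} = ENNReal.ofReal c⁻¹ := by
  have := hlam.isProbabilityMeasure_extremalLaw k
  simpa using hlam.lintegral_comp_normalize k hc (h := fun _ => 1) measurable_const

lemma IsExponentDensity.map_normalize (hlam : IsExponentDensity lam) (k : Fin d) :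
    ((exponentMeasure lam).restrict {y | 1 < y k}).map (fun y => (y k)⁻¹ • y) =
      extremalLaw lam k := by
  have hn : Measurable fun y : Fin d → ℝ => (y k)⁻¹ • y := by fun_prop
  refine Measure.ext_of_lintegral _ fun h hh => ?_
  rw [lintegral_map hh hn, hlam.lintegral_comp_normalize k one_pos hh]
  simp

/-! ### The multivariate Pareto law as a conditioned exponent measure. -/

lemma cone_diff_Icc_subset {z : Fin d → ℝ} : cone d \ Set.Icc 0 z ⊆ ⋃ k, {y | z k < y k} := by
  rintro y ⟨hy, hz⟩
  by_contra h
  simp only [Set.mem_iUnion, Set.mem_ofPred_eq, not_exists, not_lt] at h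
  exact hz ⟨hy.1, h⟩

lemma IsExponentDensity.exponentFun_ne_top (hlam : IsExponentDensity lam) {z : Fin d → ℝ}
    (hz : z ∈ orthant d) : exponentFun lam z ≠ ∞ := by
  refine ne_top_of_le_ne_top ?_ ((measure_mono cone_diff_Icc_subset).trans (measure_iUnion_le _))
  rw [tsum_fintype]
  refine ENNReal.sum_ne_top.2 fun k _ => ?_
  rw [hlam.exponentMeasure_lt k (hz k)]
  exact ENNReal.ofReal_ne_top

lemma lShape_eq (d : ℕ) : lShape d = cone d \ Set.Icc 0 1 := by
  ext y
  refine and_congr_right fun hy => ?_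
  rw [← not_le, pi_norm_le_iff_of_nonneg zero_le_one]
  simp only [Set.mem_Icc, Real.norm_eq_abs]
  refine not_congr ⟨fun h => ⟨hy.1, fun i => (le_abs_self _).trans (h i)⟩, fun h i => ?_⟩
  rw [abs_of_nonneg (hy.1 i)]
  exact h.2 i

lemma exponentMeasure_lShape : exponentMeasure lam (lShape d) = exponentFun lam 1 := by
  rw [lShape_eq, exponentFun]

lemma lt_coord_inter_cone_subset (k : Fin d) : {y | 1 < y k} ∩ cone d ⊆ lShape d :=
  fun y hy => ⟨hy.2, hy.1.trans_le ((le_abs_self _).trans (norm_le_pi_norm y k))⟩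

lemma one_mem_orthant : (1 : Fin d → ℝ) ∈ orthant d := fun _ => one_pos

lemma IsExponentDensity.exponentFun_one_ne_zero (hlam : IsExponentDensity lam) (k : Fin d) :
    exponentFun lam 1 ≠ 0 := by
  have h1 : exponentMeasure lam ({y | 1 < y k} ∩ cone d) = 1 := by
    rw [measure_inter_conull exponentMeasure_compl_cone, hlam.exponentMeasure_one_lt k]
  rw [← exponentMeasure_lShape]
  refine (lt_of_lt_of_le ?_ (measure_mono (lt_coord_inter_cone_subset k))).ne'
  rw [h1]
  exact one_pos

/-- Finite measures on `ℝ^d` concentrated on the nonnegative orthant off zero agree if their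
distribution functions agree on the open orthant. -/
lemma ext_of_Iic_orthant {ν ρ : Measure (Fin d → ℝ)} [IsFiniteMeasure ν] [IsFiniteMeasure ρ]
    (hν : ∀ᵐ y ∂ν, y ∈ cone d) (hρ : ∀ᵐ y ∂ρ, y ∈ cone d)
    (h : ∀ z ∈ orthant d, ν (Set.Iic z) = ρ (Set.Iic z)) : ν = ρ := by
  have hIic : ∀ z, ν (Set.Iic z) = ρ (Set.Iic z) := by
    intro z
    by_cases hz : ∀ i, 0 ≤ z i
    -- Boundary points are reached from inside the orthant by right-continuity of distribution
    -- functions.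
    · let a : ℕ → Fin d → ℝ := fun n i => z i + 1 / ((n : ℝ) + 1)
      have ha : ∀ n, a n ∈ orthant d := fun n i => by
        have : (0 : ℝ) < 1 / ((n : ℝ) + 1) := by positivity
        exact add_pos_of_nonneg_of_pos (hz i) this
      have hanti : Antitone fun n => Set.Iic (a n) := fun m n hmn =>
        Set.Iic_subset_Iic.2 fun i => by
          simp only [a, add_le_add_iff_left]
          exact Nat.one_div_le_one_div hmn
      have hinter : ⋂ n, Set.Iic (a n) = Set.Iic z := by
        ext y
        simp only [Set.mem_iInter, Set.mem_Iic]
        refine ⟨fun hy i => ?_, fun hy n i => (hy i).trans ?_⟩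
        · have ht : Filter.Tendsto (fun n => a n i) Filter.atTop (nhds (z i)) := by
            simpa [a] using (tendsto_one_div_add_atTop_nhds_zero_nat (𝕜 := ℝ)).const_add (z i)
          exact ge_of_tendsto' ht fun n => hy n i
        · have : (0 : ℝ) < 1 / ((n : ℝ) + 1) := by positivity
          exact le_add_of_nonneg_right this.le
      have h1 := tendsto_measure_iInter_atTop (μ := ν)
        (fun n => (measurableSet_Iic (a := a n)).nullMeasurableSet) hanti ⟨0, measure_ne_top _ _⟩
      have h2 := tendsto_measure_iInter_atTop (μ := ρ)
        (fun n => (measurableSet_Iic (a := a n)).nullMeasurableSet) hanti ⟨0, measure_ne_top _ _⟩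
      rw [hinter] at h1 h2
      refine tendsto_nhds_unique h1 ?_
      simpa only [Function.comp_def, h _ (ha _)] using h2
    · push Not at hz
      obtain ⟨i, hi⟩ := hz
      have h0 : ∀ {κ : Measure (Fin d → ℝ)}, (∀ᵐ y ∂κ, y ∈ cone d) → κ (Set.Iic z) = 0 := by
        intro κ hκ
        refine measure_eq_zero_iff_ae_notMem.2 ?_
        filter_upwards [hκ] with y hc hy
        exact absurd (hc.1 i) (not_le.2 ((hy i).trans_lt hi))
      rw [h0 hν, h0 hρ]
  have hspan : IsCountablySpanning (Set.range (Set.Iic : ℝ → Set ℝ)) := by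
    refine ⟨fun n : ℕ => Set.Iic (n : ℝ), fun n => ⟨n, rfl⟩, ?_⟩
    exact Set.eq_univ_of_forall fun x => Set.mem_iUnion.2 (exists_nat_ge x)
  have hgen : (inferInstance : MeasurableSpace (Fin d → ℝ)) =
      MeasurableSpace.generateFrom (Set.pi Set.univ '' Set.pi Set.univ
        fun _ : Fin d => Set.range (Set.Iic : ℝ → Set ℝ)) := by
    refine (generateFrom_eq_pi (fun _ => ?_) fun _ => hspan).symm
    rw [← borel_eq_generateFrom_Iic, BorelSpace.measurable_eq (α := ℝ)]
  refine ext_of_generate_finite _ hgen (IsPiSystem.pi fun _ => ?_) ?_ ?_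
  · rintro _ ⟨a, rfl⟩ _ ⟨b, rfl⟩ _
    exact ⟨min a b, Set.Iic_inter_Iic.symm⟩
  · rintro _ ⟨s, hs, rfl⟩
    choose z hz using fun i => hs i (Set.mem_univ i)
    have : Set.univ.pi s = Set.Iic z := by
      rw [← Set.pi_univ_Iic]
      exact congrArg _ (funext fun i => (hz i).symm)
    rw [this, hIic]
  -- Equality of total masses, by exhausting the space with boxes.
  · let b : ℕ → Fin d → ℝ := fun n _ => n
    have hmono : Monotone fun n => Set.Iic (b n) := fun m n hmn =>
      Set.Iic_subset_Iic.2 fun _ => by simpa [b] using hmn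
    have hunion : ⋃ n, Set.Iic (b n) = Set.univ := by
      refine Set.eq_univ_of_forall fun y => ?_
      obtain ⟨n, hn⟩ := exists_nat_ge ‖y‖
      exact Set.mem_iUnion.2 ⟨n, fun i => (le_abs_self _).trans ((norm_le_pi_norm y i).trans hn)⟩
    have h1 := tendsto_measure_iUnion_atTop (μ := ν) hmono
    have h2 := tendsto_measure_iUnion_atTop (μ := ρ) hmono
    rw [hunion] at h1 h2
    refine tendsto_nhds_unique h1 ?_
    simpa only [Function.comp_def, hIic] using h2

/-- For `z` in the open orthant `Λ(z)` is finite, so `Λ(z ∧ 1) - Λ(z)` is the measure of a set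
difference, namely of `𝓛 ∩ {y ≤ z}`. -/
lemma IsExponentDensity.eq_of_isMultivariatePareto (hlam : IsExponentDensity lam) (k : Fin d)
    {ρ : Measure (Fin d → ℝ)} (hρ : IsMultivariatePareto lam ρ) :
    ρ = (exponentMeasure lam)[|lShape d] := by
  have := hρ.prob
  have hL0 : exponentMeasure lam (lShape d) ≠ 0 := by
    rw [exponentMeasure_lShape]; exact hlam.exponentFun_one_ne_zero k
  have hLt : exponentMeasure lam (lShape d) ≠ ∞ := by
    rw [exponentMeasure_lShape]; exact hlam.exponentFun_ne_top one_mem_orthant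
  have hfin : IsFiniteMeasure ((exponentMeasure lam)[|lShape d]) := inferInstance
  refine ext_of_Iic_orthant ?_ ?_ fun z hz => ?_
  · filter_upwards [hρ.support] with y hy using hy.1
  · filter_upwards [ae_cond_mem (measurableSet_lShape d)] with y hy using hy.1
  · have hzc : z ∈ cone d := ⟨fun i => (hz i).le, fun h => by
      have := hz k; simp [h] at this⟩
    have hset : lShape d ∩ Set.Iic z =
        (cone d \ Set.Icc 0 (z ⊓ 1)) \ (cone d \ Set.Icc 0 z) := by
      rw [lShape_eq]
      ext y
      simp only [Set.mem_inter_iff, Set.mem_sdiff, Set.mem_Icc, Set.mem_Iic, le_inf_iff]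
      constructor
      · rintro ⟨⟨h1, h2⟩, h3⟩
        exact ⟨⟨h1, fun h => h2 ⟨h.1, h.2.2⟩⟩, fun h => h.2 ⟨h1.1, h3⟩⟩
      · rintro ⟨⟨h1, h2⟩, h3⟩
        have h4 : 0 ≤ y ∧ y ≤ z := by by_contra h; exact h3 ⟨h1, h⟩
        exact ⟨⟨h1, fun h => h2 ⟨h.1, h4.2, h.2⟩⟩, h4.2⟩
    rw [hρ.cdf z hzc, cond_apply (measurableSet_lShape d), hset, measure_sdiff
      (Set.sdiff_subset_sdiff_right (Set.Icc_subset_Icc_right inf_le_left))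
      ((measurableSet_cone d).diff measurableSet_Icc).nullMeasurableSet
      (hlam.exponentFun_ne_top hz), exponentMeasure_lShape, ENNReal.div_eq_inv_mul]
    rfl

lemma map_cond_preimage {α β : Type*} [MeasurableSpace α] [MeasurableSpace β] {μ : Measure α}
    {X : α → β} (hX : Measurable X) {B : Set β} (hB : MeasurableSet B) :
    (μ[|X ⁻¹' B]).map X = (μ.map X)[|B] := by
  rw [ProbabilityTheory.cond, ProbabilityTheory.cond, Measure.map_smul,
    Measure.restrict_map hX hB, Measure.map_apply hX hB]

/-- The constant `Λ(𝓛)` cancels, and no other constant appears since `Λ(y_k > 1) = 1`. -/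
lemma IsExponentDensity.cond_lShape_cond_lt (hlam : IsExponentDensity lam) (k : Fin d) :
    ((exponentMeasure lam)[|lShape d])[|{y | 1 < y k}] =
      (exponentMeasure lam).restrict {y | 1 < y k} := by
  have hLt : exponentMeasure lam (lShape d) ≠ ∞ := by
    rw [exponentMeasure_lShape]; exact hlam.exponentFun_ne_top one_mem_orthant
  have hB : (lShape d ∩ {y | 1 < y k} : Set _) =ᵐ[exponentMeasure lam] {y | 1 < y k} := by
    have hc : ∀ᵐ y ∂exponentMeasure lam, y ∈ cone d := exponentMeasure_compl_cone
    filter_upwards [hc] with y hy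
    exact propext ⟨fun h => h.2, fun h => ⟨lt_coord_inter_cone_subset k ⟨h, hy⟩, h⟩⟩
  rw [cond_cond_eq_cond_inter' (measurableSet_lShape d) (measurableSet_lt_coord k 1) hLt,
    ProbabilityTheory.cond, Measure.restrict_congr_set hB, measure_congr hB,
    hlam.exponentMeasure_one_lt k, inv_one, one_smul]

/-! ### Existence and uniqueness of the extremal function law. -/

lemma IsExponentDensity.isExtremalFunctionLaw_extremalLaw (hlam : IsExponentDensity lam)
    (k : Fin d) : IsExtremalFunctionLaw lam k (extremalLaw lam k) := by
  have hD := measurable_comp_insertAt hlam.measurable_orthantDensity k 1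
  refine ⟨hlam.isProbabilityMeasure_extremalLaw k, ?_, fun w => (orthantDensity lam
    (insertAt k 1 w)).toReal, hD.ennreal_toReal, fun w => ENNReal.toReal_nonneg, ?_, ?_⟩
  · filter_upwards [hlam.ae_extremalLaw k] with U hU using hU.2
  · rw [extremalLaw, Measure.map_map (by fun_prop) (measurable_insertAt_right k 1)]
    have h1 : (fun (u : Fin d → ℝ) (i : {i : Fin d // i ≠ k}) => u i) ∘ insertAt k 1 = id := by
      funext w i
      exact insertAt_coe k 1 w i
    rw [h1, Measure.map_id]
    congr 1
    funext w
    rw [ENNReal.ofReal_toReal]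
    by_cases h : insertAt k 1 w ∈ orthant d <;> simp [orthantDensity, h]
  · intro y hy
    have hins : insertAt k 1 (fun i => y i / y k) = (y k)⁻¹ • y := by
      rw [← inv_mul_cancel₀ (hy k).ne']
      conv_rhs => rw [← insertAt_restrict k y]
      funext i
      by_cases h : i = k
      · subst h; simp
      · simp [insertAt, h, div_eq_inv_mul]
    have hmem : (y k)⁻¹ • y ∈ orthant d := (smul_mem_orthant (inv_pos.2 (hy k))).2 hy
    beta_reduce
    rw [hins, orthantDensity, Set.indicator_of_mem hmem, ENNReal.toReal_ofReal
      (hlam.pos _ hmem).le, ← hlam.homogeneous _ (hy k) _ hmem, smul_inv_smul₀ (hy k).ne']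

lemma IsExponentDensity.isExtremalFunctionLaw_iff (hlam : IsExponentDensity lam) (k : Fin d)
    (ρ : Measure (Fin d → ℝ)) : IsExtremalFunctionLaw lam k ρ ↔ ρ = extremalLaw lam k := by
  refine ⟨fun h => ?_, fun h => h ▸ hlam.isExtremalFunctionLaw_extremalLaw k⟩
  obtain ⟨hprob, hone, f, hf, hf0, hmap, hfl⟩ := h
  have hr : Measurable fun (u : Fin d → ℝ) (i : {i : Fin d // i ≠ k}) => u i := by fun_prop
  -- The functional equation fixes `f` only at positive arguments. Elsewhere only this inequality is
  -- known; equal integrals upgrade it to a.e. equality.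
  have hle : ∀ w, orthantDensity lam (insertAt k 1 w) ≤ ENNReal.ofReal (f w) := by
    intro w
    by_cases h : insertAt k 1 w ∈ orthant d
    · have := hfl _ h
      simp only [insertAt_self, insertAt_coe, one_zpow, one_mul, div_one] at this
      rw [orthantDensity, Set.indicator_of_mem h, this]
    · simp [orthantDensity, h]
  have hQ := hlam.isProbabilityMeasure_extremalLaw k
  have hint1 : ∫⁻ w, orthantDensity lam (insertAt k 1 w) = 1 := by
    have := hlam.lintegral_extremalLaw k (g := fun _ => 1) measurable_const
    simpa using this.symm
  have hint2 : ∫⁻ w, ENNReal.ofReal (f w) = 1 := by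
    have h1 : (ρ.map fun (u : Fin d → ℝ) (i : {i : Fin d // i ≠ k}) => u i) Set.univ = 1 := by
      rw [Measure.map_apply hr MeasurableSet.univ, Set.preimage_univ, measure_univ]
    rwa [hmap, withDensity_apply _ MeasurableSet.univ, Measure.restrict_univ] at h1
  have hae := ae_eq_of_ae_le_of_lintegral_le (ae_of_all volume hle) (by simp [hint1])
    hf.ennreal_ofReal.aemeasurable (by rw [hint1, hint2])
  have hρ : (ρ.map fun (u : Fin d → ℝ) (i : {i : Fin d // i ≠ k}) => u i).map (insertAt k 1) =
      ρ := by
    rw [Measure.map_map (measurable_insertAt_right k 1) hr]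
    conv_rhs => rw [← Measure.map_id (μ := ρ)]
    refine Measure.map_congr ?_
    filter_upwards [hone] with u hu
    rw [Function.comp_apply, ← hu, insertAt_restrict, id]
  rw [← hρ, hmap, extremalLaw, withDensity_congr_ae hae]

/-! ### Radial decomposition with respect to the `ℓ₁`-norm. -/

@[fun_prop]
lemma measurable_normOne : Measurable (normOne : (Fin d → ℝ) → ℝ) := by
  unfold normOne
  fun_prop

lemma normOne_smul_of_pos {t : ℝ} (ht : 0 < t) (y : Fin d → ℝ) :
    normOne (t • y) = t * normOne y := by
  simp [normOne, abs_mul, abs_of_pos ht, Finset.mul_sum]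

lemma norm_le_normOne (y : Fin d → ℝ) : ‖y‖ ≤ normOne y :=
  (pi_norm_le_iff_of_nonneg (Finset.sum_nonneg fun _ _ => abs_nonneg _)).2 fun i =>
    Finset.single_le_sum (f := fun i => |y i|) (fun _ _ => abs_nonneg _) (Finset.mem_univ i)

lemma normOne_pos {y : Fin d → ℝ} (hy : y ≠ 0) : 0 < normOne y :=
  (norm_pos_iff.2 hy).trans_le (norm_le_normOne y)

lemma ne_zero_of_mem_orthant (k : Fin d) {y : Fin d → ℝ} (hy : y ∈ orthant d) : y ≠ 0 := by
  rintro rfl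
  exact lt_irrefl _ (hy k)

lemma measurable_paretoPDF (t r : ℝ) : Measurable (paretoPDF t r) :=
  (measurable_paretoPDFReal t r).ennreal_ofReal

lemma lintegral_paretoMeasure {G : ℝ → ℝ≥0∞} (hG : Measurable G) :
    ∫⁻ p, G p ∂paretoMeasure 1 1 =
      ∫⁻ p in Set.Ioi (1 : ℝ), ENNReal.ofReal ((p ^ 2)⁻¹) * G p := by
  rw [paretoMeasure, lintegral_withDensity_eq_lintegral_mul _ (measurable_paretoPDF 1 1) hG,
    ← setLIntegral_eq_of_support_subset (s := Set.Ici (1 : ℝ)), setLIntegral_congr Ioi_ae_eq_Ici.symm]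
  · refine setLIntegral_congr_fun measurableSet_Ioi fun p hp => ?_
    have hp : (1 : ℝ) < p := hp
    rw [Pi.mul_apply, paretoPDF_of_le hp.le]
    congr 2
    rw [show -((1 : ℝ) + 1) = -2 by norm_num, Real.rpow_neg (zero_le_one.trans hp.le)]
    norm_cast
    simp
  · intro p hp
    by_contra h
    exact hp (by simp [paretoPDF_of_lt (not_le.1 h)])

/-- Substitute `u = p / s`: the factor `s²` from `u⁻²` is cancelled by `s⁻¹` from `du` and the
weight `s⁻¹`. -/
lemma lintegral_rescale {s : ℝ} (hs : 0 < s) {G : ℝ → ℝ≥0∞} (hG : Measurable G) :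
    ∫⁻ u in Set.Ioi (0 : ℝ), ENNReal.ofReal ((u ^ 2)⁻¹) *
        {u : ℝ | 1 < u * s}.indicator (fun u => ENNReal.ofReal s⁻¹ * G u) u =
      ∫⁻ p in Set.Ioi (1 : ℝ), ENNReal.ofReal ((p ^ 2)⁻¹) * G (p / s) := by
  have hms : MeasurableSet {u : ℝ | 1 < u * s} := measurableSet_lt measurable_const (by fun_prop)
  have hm : Measurable ((Set.Ioi (0 : ℝ)).indicator fun u => ENNReal.ofReal ((u ^ 2)⁻¹) *
        {u : ℝ | 1 < u * s}.indicator (fun u => ENNReal.ofReal s⁻¹ * G u) u) := by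
    refine Measurable.indicator (Measurable.mul (by fun_prop) ?_) measurableSet_Ioi
    exact Measurable.indicator (by fun_prop) hms
  rw [← lintegral_indicator measurableSet_Ioi, ← lintegral_indicator measurableSet_Ioi,
    lintegral_eq_lintegral_comp_smul _ (inv_pos.2 hs) hm,
    ← lintegral_const_mul' _ _ ENNReal.ofReal_ne_top]
  refine lintegral_congr fun p => ?_
  by_cases hp : 1 < p
  · have hp0 : 0 < p := zero_lt_one.trans hp
    have h1 : s⁻¹ • p ∈ Set.Ioi (0 : ℝ) := mul_pos (inv_pos.2 hs) hp0
    have h2 : s⁻¹ • p * s = p := by rw [smul_eq_mul]; field_simp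
    rw [Set.indicator_of_mem h1, Set.indicator_of_mem (show s⁻¹ • p ∈ {u : ℝ | 1 < u * s} by
      rw [Set.mem_ofPred_eq, h2]; exact hp), Set.indicator_of_mem (show p ∈ Set.Ioi (1 : ℝ) from hp),
      ← mul_assoc, ← mul_assoc, ← ENNReal.ofReal_mul (by positivity),
      ← ENNReal.ofReal_mul (by positivity), smul_eq_mul, Module.finrank_self, pow_one,
      inv_mul_eq_div s p]
    congr 2
    field_simp
  · rw [Set.indicator_of_notMem (show p ∉ Set.Ioi (1 : ℝ) from hp)]
    by_cases h1 : s⁻¹ • p ∈ Set.Ioi (0 : ℝ)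
    · have h2 : s⁻¹ • p * s = p := by rw [smul_eq_mul]; field_simp
      rw [Set.indicator_of_mem h1, Set.indicator_of_notMem (show s⁻¹ • p ∉ {u : ℝ | 1 < u * s} by
        rw [Set.mem_ofPred_eq, h2]; exact hp), mul_zero, mul_zero]
    · rw [Set.indicator_of_notMem h1, mul_zero]

lemma measurable_radial {g : (Fin d → ℝ) → ℝ≥0∞} (hg : Measurable g) :
    Measurable fun q : (Fin d → ℝ) × ℝ => g ((q.2 / normOne q.1) • q.1) := by
  exact hg.comp (by fun_prop)

/-- The exponent measure outside the unit `ℓ₁`-ball is the sum over `k` of the laws of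
`P • U^k / ‖U^k‖₁`, for `P` standard Pareto and independent of the extremal function `U^k`. -/
lemma IsExponentDensity.setLIntegral_one_lt_normOne (hlam : IsExponentDensity lam) (k₀ : Fin d)
    {g : (Fin d → ℝ) → ℝ≥0∞} (hg : Measurable g) :
    ∫⁻ y in {y | 1 < normOne y}, g y ∂exponentMeasure lam =
      ∑ k, ∫⁻ U, ∫⁻ p, g ((p / normOne U) • U) ∂paretoMeasure 1 1 ∂extremalLaw lam k := by
  have hS : MeasurableSet {y : Fin d → ℝ | 1 < normOne y} :=
    measurableSet_lt measurable_const measurable_normOne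
  -- Partition of unity. At `y = u • U` with `U k = 1` the `k`-th weight is `1 / ‖U‖₁`, the factor
  -- required by `lintegral_rescale`.
  let F : Fin d → (Fin d → ℝ) → ℝ≥0∞ := fun k => {y | 1 < normOne y}.indicator fun y =>
    ENNReal.ofReal (y k / normOne y) * g y
  have hF : ∀ k, Measurable (F k) := fun k => by
    refine Measurable.indicator (Measurable.mul ?_ hg) hS
    exact ((measurable_pi_apply k).div measurable_normOne).ennreal_ofReal
  have hsum : ∫⁻ y in {y | 1 < normOne y}, g y ∂exponentMeasure lam =
      ∫⁻ y, ∑ k, F k y ∂exponentMeasure lam := by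
    rw [← lintegral_indicator hS]
    refine lintegral_congr_ae ?_
    filter_upwards [ae_exponentMeasure_mem_orthant k₀] with y hy
    by_cases h : y ∈ {y : Fin d → ℝ | 1 < normOne y}
    · have hpos := normOne_pos (ne_zero_of_mem_orthant k₀ hy)
      have h1 : ∑ k, y k / normOne y = 1 := by
        rw [← Finset.sum_div, div_eq_one_iff_eq hpos.ne', normOne]
        exact Finset.sum_congr rfl fun i _ => (abs_of_pos (hy i)).symm
      simp only [F, Set.indicator_of_mem h]
      rw [← Finset.sum_mul, ← ENNReal.ofReal_sum_of_nonneg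
        fun k _ => div_nonneg (hy k).le hpos.le, h1, ENNReal.ofReal_one, one_mul]
    · simp [F, Set.indicator_of_notMem h]
  rw [hsum, lintegral_finsetSum _ fun k _ => hF k]
  refine Finset.sum_congr rfl fun k _ => ?_
  rw [hlam.lintegral_exponentMeasure k (hF k)]
  refine lintegral_congr_ae ?_
  filter_upwards [hlam.ae_extremalLaw k] with U ⟨hU, hUk⟩
  have hpos := normOne_pos (ne_zero_of_mem_orthant k hU)
  rw [lintegral_paretoMeasure (G := fun p => g ((p / normOne U) • U)) (by fun_prop),
    ← lintegral_rescale hpos (G := fun u => g (u • U)) (by fun_prop)]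
  refine setLIntegral_congr_fun measurableSet_Ioi fun u hu => ?_
  have hu : 0 < u := hu
  have hn := normOne_smul_of_pos hu U
  by_cases h : 1 < u * normOne U
  · simp only [F]
    rw [Set.indicator_of_mem (show u • U ∈ {y : Fin d → ℝ | 1 < normOne y} by
      rw [Set.mem_ofPred_eq, hn]; exact h), Set.indicator_of_mem (show u ∈ {u : ℝ | 1 < u * normOne U} from h), hn,
      Pi.smul_apply, hUk, smul_eq_mul, mul_one, div_mul_eq_div_div, div_self hu.ne', one_div]
  · simp only [F]
    rw [Set.indicator_of_notMem (show u • U ∉ {y : Fin d → ℝ | 1 < normOne y} by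
      rw [Set.mem_ofPred_eq, hn]; exact h), Set.indicator_of_notMem (show u ∉ {u : ℝ | 1 < u * normOne U} from h)]

/-- The direction `y / ‖y‖₁` is unchanged under positive scaling, so `Y^k` and `Y^k / Y^k_k` are
interchangeable in the sampler. -/
lemma IsExponentDensity.lintegral_radial_restrict (hlam : IsExponentDensity lam) (k : Fin d)
    {g : (Fin d → ℝ) → ℝ≥0∞} (hg : Measurable g) :
    ∫⁻ y in {y | 1 < y k}, ∫⁻ p, g ((p / normOne y) • y) ∂paretoMeasure 1 1
        ∂exponentMeasure lam =
      ∫⁻ U, ∫⁻ p, g ((p / normOne U) • U) ∂paretoMeasure 1 1 ∂extremalLaw lam k := by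
  have hn : Measurable fun y : Fin d → ℝ => (y k)⁻¹ • y := by fun_prop
  have : IsProbabilityMeasure (paretoMeasure 1 1) :=
    isProbabilityMeasure_paretoMeasure one_pos one_pos
  rw [← hlam.map_normalize k, lintegral_map (measurable_radial hg).lintegral_prod_right' hn]
  refine setLIntegral_congr_fun (measurableSet_lt_coord k 1) fun y hy => ?_
  have hy : 0 < (y k)⁻¹ := inv_pos.2 (zero_lt_one.trans hy)
  refine lintegral_congr fun p => ?_
  rw [normOne_smul_of_pos hy, smul_smul]
  congr 2
  rw [mul_comm (y k)⁻¹, div_mul_eq_div_div, div_mul_cancel₀ _ hy.ne']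

/-! ### The random index and the rejection sampler. -/

/-- Integration against the law of `(P, Yc_T)` for an index `T` that is independent of the pair. -/
lemma lintegral_mixture {Ω : Type*} [MeasurableSpace Ω] {μ : Measure Ω} [IsProbabilityMeasure μ]
    {P : Ω → ℝ} {T : Ω → Fin d} {Yc : Fin d → Ω → Fin d → ℝ}
    (hP : Measurable P) (hT : Measurable T) (hY : ∀ k, Measurable (Yc k))
    (hTu : ∀ k, μ {ω | T ω = k} = (d : ℝ≥0∞)⁻¹)
    (hPTY : IndepFun P (fun ω => (T ω, fun k => Yc k ω)) μ)
    (hTY : IndepFun T (fun ω k => Yc k ω) μ)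
    {G : (Fin d → ℝ) × ℝ → ℝ≥0∞} (hG : Measurable G) :
    ∫⁻ ω, G (Yc (T ω) ω, P ω) ∂μ =
      (d : ℝ≥0∞)⁻¹ * ∑ k, ∫⁻ y, ∫⁻ p, G (y, p) ∂(μ.map P) ∂(μ.map (Yc k)) := by
  have hsplit : ∀ ω, G (Yc (T ω) ω, P ω) =
      ∑ k, ({k} : Set (Fin d)).indicator (fun _ => (1 : ℝ≥0∞)) (T ω) * G (Yc k ω, P ω) := by
    intro ω
    rw [Finset.sum_eq_single (T ω)]
    · simp
    · intro k _ hk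
      simp [hk.symm]
    · simp
  have hind : ∀ k, Measurable (({k} : Set (Fin d)).indicator fun _ => (1 : ℝ≥0∞)) := fun k =>
    measurable_const.indicator (measurableSet_singleton k)
  simp_rw [hsplit]
  have hterm : ∀ k, Measurable fun ω =>
      ({k} : Set (Fin d)).indicator (fun _ => (1 : ℝ≥0∞)) (T ω) * G (Yc k ω, P ω) := fun k =>
    ((hind k).comp hT).mul (hG.comp ((hY k).prodMk hP))
  rw [lintegral_finsetSum _ fun k _ => hterm k, Finset.mul_sum]
  refine Finset.sum_congr rfl fun k _ => ?_
  have := Measure.isProbabilityMeasure_map (μ := μ) hP.aemeasurable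
  have := Measure.isProbabilityMeasure_map (μ := μ) hT.aemeasurable
  have := Measure.isProbabilityMeasure_map (μ := μ) (hY k).aemeasurable
  -- After splitting by the value of `T`, each term involves a single `Yc k`; the dependence within
  -- the family is irrelevant.
  have hTk : IndepFun T (Yc k) μ := hTY.comp measurable_id (measurable_pi_apply k)
  have hPk : IndepFun (fun ω => (T ω, Yc k ω)) P μ :=
    (hPTY.comp (ψ := fun q : Fin d × (Fin d → Fin d → ℝ) => (q.1, q.2 k)) measurable_id
      (by fun_prop)).symm
  have hjoint : μ.map (fun ω => ((T ω, Yc k ω), P ω)) =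
      ((μ.map T).prod (μ.map (Yc k))).prod (μ.map P) := by
    rw [(indepFun_iff_map_prod_eq_prod_map_map (hT.prodMk (hY k)).aemeasurable
      hP.aemeasurable).1 hPk, (indepFun_iff_map_prod_eq_prod_map_map hT.aemeasurable
      (hY k).aemeasurable).1 hTk]
  have hH : Measurable fun q : (Fin d × (Fin d → ℝ)) × ℝ =>
      ({k} : Set (Fin d)).indicator (fun _ => (1 : ℝ≥0∞)) q.1.1 * G (q.1.2, q.2) :=
    ((hind k).comp (measurable_fst.comp measurable_fst)).mul (hG.comp (by fun_prop))
  have hinner : Measurable fun y => ∫⁻ p, G (y, p) ∂(μ.map P) := hG.lintegral_prod_right'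
  calc ∫⁻ ω, ({k} : Set (Fin d)).indicator (fun _ => (1 : ℝ≥0∞)) (T ω) * G (Yc k ω, P ω) ∂μ
      = ∫⁻ q, ({k} : Set (Fin d)).indicator (fun _ => (1 : ℝ≥0∞)) q.1.1 * G (q.1.2, q.2)
          ∂(μ.map fun ω => ((T ω, Yc k ω), P ω)) :=
        (lintegral_map hH ((hT.prodMk (hY k)).prodMk hP)).symm
    _ = ∫⁻ t, ∫⁻ y, ∫⁻ p, ({k} : Set (Fin d)).indicator (fun _ => (1 : ℝ≥0∞)) t * G (y, p)
          ∂(μ.map P) ∂(μ.map (Yc k)) ∂(μ.map T) := by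
        rw [hjoint, lintegral_prod _ hH.aemeasurable,
          lintegral_prod _ hH.lintegral_prod_right'.aemeasurable]
    _ = ∫⁻ t, ({k} : Set (Fin d)).indicator (fun _ => (1 : ℝ≥0∞)) t *
          ∫⁻ y, ∫⁻ p, G (y, p) ∂(μ.map P) ∂(μ.map (Yc k)) ∂(μ.map T) := by
        refine lintegral_congr fun t => ?_
        rw [← lintegral_const_mul _ hinner]
        refine lintegral_congr fun y => ?_
        exact lintegral_const_mul _ (hG.comp measurable_prodMk_left)
    _ = _ := by
        rw [lintegral_mul_const _ (hind k), lintegral_indicator_const (measurableSet_singleton k),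
          one_mul, Measure.map_apply hT (measurableSet_singleton k)]
        exact congrArg (· * _) (hTu k)

end ExtremalPareto

theorem lemma2 {d : ℕ} (lam : (Fin d → ℝ) → ℝ)
    (hlam : ExtremalPareto.IsExponentDensity lam)
    {Ω : Type u} [MeasurableSpace Ω] (μ : Measure Ω) [IsProbabilityMeasure μ]
    (Y : Ω → Fin d → ℝ) (hYm : Measurable Y)
    (hY : ExtremalPareto.IsMultivariatePareto lam (μ.map Y)) :
    -- the law of the extremal function relative to `k` is the law of `Y^k / Y^k_k`
    (∀ (k : Fin d) (ρ : Measure (Fin d → ℝ)),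
      ExtremalPareto.IsExtremalFunctionLaw lam k ρ ↔
        ρ = (μ[|{ω | 1 < Y ω k}]).map (fun ω => (Y ω k)⁻¹ • Y ω)) ∧
    -- `P` standard Pareto, `T` uniform, `Yc k` distributed as `Y` given `Y_k > 1`;
    -- `P`, `T` and the family `(Yc k)_k` are independent
    (∀ (Ω' : Type v) [MeasurableSpace Ω'] (μ' : Measure Ω') [IsProbabilityMeasure μ']
      (P : Ω' → ℝ) (T : Ω' → Fin d) (Yc : Fin d → Ω' → Fin d → ℝ),
      Measurable P → Measurable T → (∀ k, Measurable (Yc k)) →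
      μ'.map P = paretoMeasure 1 1 →
      (∀ k, μ' {ω | T ω = k} = (d : ℝ≥0∞)⁻¹) →
      (∀ k, μ'.map (Yc k) = (μ[|{ω | 1 < Y ω k}]).map Y) →
      IndepFun P (fun ω => (T ω, fun k => Yc k ω)) μ' →
      IndepFun T (fun ω k => Yc k ω) μ' →
      μ.map Y =
        (μ'[|{ω | 1 < P ω * ‖Yc (T ω) ω‖ / ExtremalPareto.normOne (Yc (T ω) ω)}]).map
          (fun ω => (P ω / ExtremalPareto.normOne (Yc (T ω) ω)) • Yc (T ω) ω) ∧
      μ' {ω | 1 < P ω * ‖Yc (T ω) ω‖ / ExtremalPareto.normOne (Yc (T ω) ω)} =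
        ExtremalPareto.exponentFun lam 1 / (d : ℝ≥0∞)) := by
  open ExtremalPareto in
  have hcond : ∀ k, (μ[|{ω | 1 < Y ω k}]).map Y =
      (exponentMeasure lam).restrict {y | 1 < y k} := by
    intro k
    rw [← hlam.cond_lShape_cond_lt k, ← hlam.eq_of_isMultivariatePareto k hY]
    exact map_cond_preimage hYm (measurableSet_lt_coord k 1)
  refine ⟨fun k ρ => ?_, ?_⟩
  · have hn : Measurable fun y : Fin d → ℝ => (y k)⁻¹ • y := by fun_prop
    rw [hlam.isExtremalFunctionLaw_iff k, ← hlam.map_normalize k, ← hcond k,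
      Measure.map_map hn hYm]
    rfl
  · intro Ω' _ μ' _ P T Yc hP hT hYc hPlaw hTu hYclaw hPTY hTY
    have hne : Nonempty Ω' := nonempty_of_isProbabilityMeasure μ'
    -- A value of `T` witnesses `d ≥ 1`.
    let k₀ : Fin d := T hne.some
    have hd0 : (d : ℝ≥0∞) ≠ 0 := Nat.cast_ne_zero.2 k₀.pos.ne'
    have hdt : (d : ℝ≥0∞) ≠ ∞ := ENNReal.natCast_ne_top d
    have hYT : Measurable fun ω => Yc (T ω) ω :=
      (measurable_from_prod_countable_right (f := fun q : Fin d × Ω' => Yc q.1 q.2) hYc).comp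
        (hT.prodMk measurable_id)
    set Z : Ω' → Fin d → ℝ := fun ω => (P ω / normOne (Yc (T ω) ω)) • Yc (T ω) ω with hZ
    have hZm : Measurable Z :=
      (hP.div (measurable_normOne.comp hYT)).smul hYT
    have hZlaw : μ'.map Z =
        (d : ℝ≥0∞)⁻¹ • (exponentMeasure lam).restrict {y | 1 < normOne y} := by
      refine Measure.ext_of_lintegral _ fun g hg => ?_
      rw [lintegral_map hg hZm, lintegral_smul_measure, hlam.setLIntegral_one_lt_normOne k₀ hg,
        lintegral_mixture hP hT hYc hTu hPTY hTY (measurable_radial hg), smul_eq_mul]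
      congr 1
      refine Finset.sum_congr rfl fun k _ => ?_
      rw [hPlaw, hYclaw, hcond, hlam.lintegral_radial_restrict k hg]
    have hPone : ∀ᵐ ω ∂μ', 1 ≤ P ω := by
      refine ae_of_ae_map hP.aemeasurable (p := fun p => 1 ≤ p) ?_
      rw [hPlaw, paretoMeasure, ae_withDensity_iff (measurable_paretoPDF 1 1)]
      refine ae_of_all _ fun p hp => ?_
      by_contra h
      exact hp (paretoPDF_of_lt (not_le.1 h))
    have hcone : ∀ᵐ ω ∂μ', ∀ k, Yc k ω ∈ cone d := by
      refine ae_all_iff.2 fun k => ae_of_ae_map (hYc k).aemeasurable ?_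
      rw [hYclaw, hcond]
      exact ae_restrict_of_ae exponentMeasure_compl_cone
    -- The event only says `‖Z‖ > 1`; membership of `Z` in the cone holds almost surely.
    have hev : {ω | 1 < P ω * ‖Yc (T ω) ω‖ / normOne (Yc (T ω) ω)} =ᵐ[μ'] Z ⁻¹' lShape d := by
      filter_upwards [hPone, hcone] with ω hω hc
      have hc := hc (T ω)
      have hr : 0 < P ω / normOne (Yc (T ω) ω) :=
        div_pos (zero_lt_one.trans_le hω) (normOne_pos hc.2)
      have hnorm : ‖Z ω‖ = P ω * ‖Yc (T ω) ω‖ / normOne (Yc (T ω) ω) := by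
        rw [hZ, norm_smul, Real.norm_of_nonneg hr.le, div_mul_eq_mul_div]
      have hZc : Z ω ∈ cone d :=
        ⟨fun i => mul_nonneg hr.le (hc.1 i), smul_ne_zero hr.ne' hc.2⟩
      refine propext (Iff.trans ?_ (and_iff_right hZc).symm)
      rw [hnorm]
      rfl
    have hLsub : lShape d ⊆ {y | 1 < normOne y} := fun y hy => hy.2.trans_le (norm_le_normOne y)
    have hprob : μ' (Z ⁻¹' lShape d) = (d : ℝ≥0∞)⁻¹ * exponentMeasure lam (lShape d) := by
      rw [← Measure.map_apply hZm (measurableSet_lShape d), hZlaw, Measure.smul_apply, smul_eq_mul,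
        Measure.restrict_apply (measurableSet_lShape d), Set.inter_eq_left.2 hLsub]
    refine ⟨?_, ?_⟩
    · rw [ProbabilityTheory.cond, Measure.restrict_congr_set hev, measure_congr hev,
        ← ProbabilityTheory.cond, map_cond_preimage hZm (measurableSet_lShape d),
        hlam.eq_of_isMultivariatePareto k₀ hY, hZlaw, ProbabilityTheory.cond,
        ProbabilityTheory.cond, Measure.restrict_smul, Measure.smul_apply,
        Measure.restrict_restrict (measurableSet_lShape d),
        Measure.restrict_apply (measurableSet_lShape d), Set.inter_eq_left.2 hLsub, smul_smul,
        smul_eq_mul, ENNReal.mul_inv (Or.inl (ENNReal.inv_ne_zero.2 hdt))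
        (Or.inl (ENNReal.inv_ne_top.2 hd0)), inv_inv, mul_right_comm, ENNReal.mul_inv_cancel hd0 hdt,
        one_mul]
    · rw [measure_congr hev, hprob, exponentMeasure_lShape, ENNReal.div_eq_inv_mul]
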